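/- Let $(\Omega,\mathcal F,\{\mathcal F_t\}_{t\ge 0},P)$ be a filtered probability space in discrete time, let $\mathcal H$ be a (possibly uncountable) measurable space, and let $\{M_t(h)\}_{t\ge 0}$, $h\in\mathcal H$, be a family of martingales with $M_0(h)=0$ a.s., each $M_t(h)(\omega)$ being jointly measurable in $(h,\omega)$. Put $\xi_t(h)=M_t(h)-M_{t-1}(h)$ and suppose that, for every $h\in\mathcal H$, almost surely $|\xi_t(h)|\le e^2$ for all $t\ge 1$. Let $V_t(h)=\sum_{i=1}^t \mathbb E[\xi_i(h)^2\mid\mathcal F_{i-1}]$ be the conditional variance processes, in a version jointly measurable in $(h,\omega)$. For a probability distribution $\rho$ on $\mathcal H$ write $\mathbb E_\rho M_t=\int M_t(h)\,\rho(dh)$ and $\mathbb E_\rho V_t=\int V_t(h)\,\rho(dh)$, and let $KL(\rho\|\pi)\in[0,\infty]$ be the Kullback--Leibler divergence. Fix a probability distribution $\pi$ on $\mathcal H$ and $0<\delta<1$. Put $\lambda_0=\frac{1}{e^2(1+\sqrt{1/3})}$ and $$\tau_0(\rho)=\min\Bigl\{s: 2(e-2)\,\mathbb E_\rho V_s\ \ge\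 \frac{2}{\lambda_0^2}\Bigl(\ln\frac4\delta+KL(\rho\|\pi)\Bigr)\Bigr\},$$ with $\min\emptyset=\infty$ (so $\tau_0(\rho)=\infty$ whenever $KL(\rho\|\pi)=\infty$). Then there is an event of probability at least $1-\delta$ on which the following holds simultaneously for all probability distributions $\rho$ on $\mathcal H$. If $KL(\rho\|\pi)<\infty$, then $M_t(\cdot)$ and $V_t(\cdot)$ are $\rho$-integrable for all $t$; and for all $t\ge\tau_0(\rho)$ (which forces $KL(\rho\|\pi)<\infty$), $$|\mathbb E_\rho M_t|\le\frac{2(e-2)}{e^2\bigl(1+\sqrt{1/3}\bigr)}\,\mathbb E_\rho V_t$$ and $$|\mathbb E_\rho M_t|\le\sqrt{6(e-2)\,\mathbb E_\rho V_t\Bigl(2\ln\ln\frac{3(e-2)\,\mathbb E_\rho V_t}{|\mathbb E_\rho M_t|}+\ln\frac2\delta+KL(\rho\|\pi)\Bigr)}.$$ (The second inequality is trivially true when $\mathbb E_\rho M_t=0$.) -/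

import Mathlib

open MeasureTheory ProbabilityTheory

namespace PACBayesLIL

/-- `V` is a version of the conditional variance processes of the family `M`: it is measurable
in the index and the outcome jointly, and for each index `h` and time `t`, almost surely,
`V t h = ∑ i in 1..t, E[(M i h - M (i-1) h)^2 | F (i-1)]`.  Joint measurability is what makes the
averages over the index meaningful; the conditional expectations are determined only up to null
sets for each index separately. -/
structure IsCondVariance {Ω H : Type*} {mΩ : MeasurableSpace Ω} [MeasurableSpace H]
    (P : Measure Ω) (F : Filtration ℕ mΩ) (M V : ℕ → H → Ω → ℝ) : Prop where
  measurable : ∀ t : ℕ, Measurable (fun p : H × Ω => V t p.1 p.2)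
  ae_eq : ∀ (t : ℕ) (h : H), V t h =ᵐ[P]
    fun ω => ∑ i ∈ Finset.Icc 1 t,
      (P[fun ω' => (M i h ω' - M (i - 1) h ω') ^ 2 | F (i - 1)]) ω

/-- The mean of a process at time `t` over the index distribution `ρ`, at the outcome `ω`. -/
noncomputable def mixMean {Ω H : Type*} [MeasurableSpace H]
    (X : ℕ → H → Ω → ℝ) (ρ : Measure H) (t : ℕ) (ω : Ω) : ℝ :=
  ∫ h, X t h ω ∂ρ

/-- `λ₀ = 1 / (e² (1 + √(1/3)))`. -/
noncomputable def lambda0 : ℝ := 1 / (Real.exp 1 ^ 2 * (1 + Real.sqrt (1 / 3)))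

/-- The first time `s` at which
`2 (e - 2) E_ρ V_s ≥ (2 / λ₀²) (ln (4 / δ) + KL(ρ ‖ π))`, equal to `⊤` if there is none (in
particular if the divergence is infinite). -/
noncomputable def tau0 {Ω H : Type*} [MeasurableSpace H] (V : ℕ → H → Ω → ℝ) (prior : Measure H)
    (δ : ℝ) (ρ : Measure H) (ω : Ω) : ℕ∞ :=
  sInf ((fun s : ℕ => (s : ℕ∞)) '' {s : ℕ |
    ENNReal.ofReal (2 / lambda0 ^ 2) *
        (ENNReal.ofReal (Real.log (4 / δ)) + InformationTheory.klDiv ρ prior)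
      ≤ ENNReal.ofReal (2 * (Real.exp 1 - 2) * mixMean V ρ s ω)})

end PACBayesLIL

namespace PACBayesLIL

/-! For fixed `h` and `|l| ≤ e⁻²`, the inequality `eˣ ≤ 1 + x + (e - 2) x²` on `[-1, 1]` gives `exp
(l M - l² (e - 2) V)` the supermartingale inequality. Averaging over `h` under the prior and over
`l` under a probability law preserves it, and Ville's inequality bounds the average at all times at
once. That event does not involve `ρ`; Donsker-Varadhan then replaces the prior average by the
exponential at the `ρ`-means, at the cost of a factor `exp KL`, for every `ρ` simultaneously.

Three laws of `l` are used. The point masses at `±λ₀` give the linear bound, because from `τ₀` on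
the term `ln (4/δ) + KL` is absorbed by `λ₀² (e - 2) E_ρ V`. With `m = E_ρ M` and `U = 2 (e - 2) E_ρ
V`, that bound reads `|m| / U ≤ λ₀`, so the optimal parameter `x = |m| / U`, and even `x (1 +
√(1/3))`, stays within `e⁻²`. The third law has density `1 / (|l| (log |l|)²)`. It gives mass at
least `1 / (log (3 / (2x)))²` to the parameters within `x √(1/3)` of `x` (or of `-x` if `m < 0`),
where the exponent is at least `m² / (3U)`. Taking logarithms yields the iterated-logarithm bound.
-/

theorem exp_le_one_add_add_sq {x : ℝ} (hx : |x| ≤ 1) :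
    Real.exp x ≤ 1 + x + (Real.exp 1 - 2) * x ^ 2 := by
  have key : ∀ y : ℝ, HasSum (fun n : ℕ => y ^ (n + 2) / (n + 2).factorial)
      (Real.exp y - 1 - y) := by
    intro y
    have h := NormedSpace.expSeries_div_hasSum_exp y
    rw [← Real.exp_eq_exp_ℝ] at h
    have h2 := (hasSum_nat_add_iff' 2).2 h
    simpa [Finset.sum_range_succ, sub_sub] using h2
  have h1 := (key 1).mul_left (x ^ 2)
  -- Termwise comparison of the two series: `x ^ (n + 2) ≤ x ^ 2` when `|x| ≤ 1`.
  have h2 := hasSum_le (fun n => ?_) (key x) h1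
  · linarith
  · have hle : x ^ n ≤ 1 := (le_abs_self _).trans (by
      rw [abs_pow]; exact pow_le_one₀ (abs_nonneg _) hx)
    rw [pow_add, one_pow, mul_one_div, mul_comm (x ^ n)]
    gcongr
    nlinarith [sq_nonneg x]

/-- One half of the Donsker-Varadhan variational formula. -/
theorem exp_integral_sub_klDiv_le_integral_exp {H : Type*} [MeasurableSpace H] {ρ π : Measure H}
    [IsProbabilityMeasure ρ] [IsProbabilityMeasure π]
    (hkl : InformationTheory.klDiv ρ π ≠ ⊤) {f : H → ℝ} (hf : Integrable f ρ)
    (hexp : Integrable (fun h => Real.exp (f h)) π) :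
    Real.exp (∫ h, f h ∂ρ - (InformationTheory.klDiv ρ π).toReal) ≤
      ∫ h, Real.exp (f h) ∂π := by
  obtain ⟨hac, hint⟩ := InformationTheory.klDiv_ne_top_iff.1 hkl
  have hpos : 0 < ∫ h, Real.exp (f h) ∂π := integral_exp_pos hexp
  have := isProbabilityMeasure_tilted hexp
  have hac' : ρ ≪ π.tilted f := hac.trans (absolutelyContinuous_tilted hexp)
  -- The divergence of `ρ` from the tilt of `π` by `f` is `KL - ∫ f ∂ρ + log ∫ exp f ∂π`; its
  -- nonnegativity is the claim.
  have h := integral_llr_tilted_right hac hf hexp hint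
  have hnn := InformationTheory.integral_llr_add_sub_measure_univ_nonneg hac'
    (integrable_llr_tilted_right hac hf hint hexp)
  rw [InformationTheory.toReal_klDiv_of_measure_eq hac (by simp),
    ← Real.le_log_iff_exp_le hpos]
  simp only [probReal_univ] at hnn
  linarith

/-! ### Ville's maximal inequality. -/

theorem Supermartingale.ville_finite {Ω : Type*} {mΩ : MeasurableSpace Ω} {P : Measure Ω}
    [IsProbabilityMeasure P] {F : Filtration ℕ mΩ} {Y : ℕ → Ω → ℝ} (hY : Supermartingale Y F P)
    (c : ℝ) (n : ℕ) :
    c * P.real {ω | ∃ k ≤ n, c ≤ Y k ω} + ∫ ω in {ω | ∃ k ≤ n, c ≤ Y k ω}ᶜ, Y n ω ∂P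
      ≤ ∫ ω, Y 0 ω ∂P := by
  have hS : ∀ k, MeasurableSet[F k] {ω | c ≤ Y k ω} := fun k =>
    (hY.1 k).measurable measurableSet_Ici
  have hE : ∀ n, MeasurableSet[F n] {ω | ∃ k ≤ n, c ≤ Y k ω} := by
    intro n
    have : {ω | ∃ k ≤ n, c ≤ Y k ω} = ⋃ k ∈ Set.Iic n, {ω | c ≤ Y k ω} := by ext; simp
    rw [this]
    exact MeasurableSet.biUnion (Set.to_countable _) (fun k hk => F.mono hk _ (hS k))
  have hge : ∀ (n : ℕ) (A : Set Ω), MeasurableSet A → (∀ ω ∈ A, c ≤ Y n ω) →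
      c * P.real A ≤ ∫ ω in A, Y n ω ∂P := by
    intro n A hA h
    have := setIntegral_mono_on (μ := P) (s := A) (f := fun _ => c) (integrable_const c).integrableOn
      (hY.integrable n).integrableOn hA h
    simpa [mul_comm] using this
  -- The integral over paths that have not yet crossed makes the induction close: at each step, the
  -- newly crossing paths leave it and contribute at least `c` times their probability.
  induction n with
  | zero =>
    have hm := F.le 0 _ (hE 0)
    rw [← integral_add_compl hm (hY.integrable 0)]
    gcongr
    exact hge 0 _ hm (by simp)
  | succ n ih =>
    refine le_trans ?_ ih
    have hm := F.le n _ (hE n)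
    have hm' := F.le _ _ (hE (n + 1))
    have hsub : {ω | ∃ k ≤ n, c ≤ Y k ω} ⊆ {ω | ∃ k ≤ n + 1, c ≤ Y k ω} :=
      fun ω ⟨k, hk, h⟩ => ⟨k, hk.trans n.le_succ, h⟩
    have hdiff := hm'.diff hm
    have hstep := hY.setIntegral_le n.le_succ (hE n).compl
    have hsplit : ({ω | ∃ k ≤ n, c ≤ Y k ω}ᶜ : Set Ω) =
        ({ω | ∃ k ≤ n + 1, c ≤ Y k ω} \ {ω | ∃ k ≤ n, c ≤ Y k ω}) ∪
          {ω | ∃ k ≤ n + 1, c ≤ Y k ω}ᶜ := by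
      ext ω
      have := @hsub ω
      simp only [Set.mem_compl_iff, Set.mem_union, Set.mem_sdiff] at *
      tauto
    have hdisj : Disjoint ({ω | ∃ k ≤ n + 1, c ≤ Y k ω} \ {ω | ∃ k ≤ n, c ≤ Y k ω})
        ({ω | ∃ k ≤ n + 1, c ≤ Y k ω}ᶜ) :=
      Set.disjoint_left.2 fun ω h h' => h' h.1
    have hi := setIntegral_union hdisj hm'.compl (hY.integrable (n + 1)).integrableOn
      (hY.integrable (n + 1)).integrableOn
    rw [← hsplit] at hi
    have hg := hge (n + 1) _ hdiff (by
      rintro ω ⟨⟨k, hk, h⟩, h'⟩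
      rcases hk.lt_or_eq with hk | rfl
      · exact absurd ⟨k, Nat.lt_succ_iff.1 hk, h⟩ h'
      · exact h)
    rw [measureReal_sdiff hsub hm] at hg
    simp only [Nat.succ_eq_add_one] at hstep
    linarith

/-- Ville's maximal inequality. -/
theorem Supermartingale.ville {Ω : Type*} {mΩ : MeasurableSpace Ω} {P : Measure Ω}
    [IsProbabilityMeasure P] {F : Filtration ℕ mΩ} {Y : ℕ → Ω → ℝ} (hY : Supermartingale Y F P)
    (hnn : ∀ n, 0 ≤ᵐ[P] Y n) {c : ℝ} (hc : 0 < c) :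
    P {ω | ∃ k, c ≤ Y k ω} ≤ ENNReal.ofReal ((∫ ω, Y 0 ω ∂P) / c) := by
  have hU : {ω | ∃ k, c ≤ Y k ω} = ⋃ n, {ω | ∃ k ≤ n, c ≤ Y k ω} := by
    ext ω
    simp only [Set.mem_ofPred_eq, Set.mem_iUnion]
    exact ⟨fun ⟨k, h⟩ => ⟨k, k, le_rfl, h⟩, fun ⟨_, k, _, h⟩ => ⟨k, h⟩⟩
  have hmono : Monotone fun n => {ω | ∃ k ≤ n, c ≤ Y k ω} :=
    fun a b hab ω ⟨k, hk, h⟩ => ⟨k, hk.trans hab, h⟩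
  rw [hU, hmono.measure_iUnion]
  refine iSup_le fun n => ?_
  have h := Supermartingale.ville_finite hY c n
  have h0 : 0 ≤ ∫ ω in {ω | ∃ k ≤ n, c ≤ Y k ω}ᶜ, Y n ω ∂P :=
    integral_nonneg_of_ae (ae_restrict_of_ae (hnn n))
  rw [← ofReal_measureReal]
  refine ENNReal.ofReal_le_ofReal ?_
  rw [le_div_iff₀ hc]
  linarith

/-! ### Averages of processes adapted only parameter by parameter. -/

theorem integral_condExp_mul_eq {Ω : Type*} {m mΩ : MeasurableSpace Ω} {P : Measure Ω}
    [IsProbabilityMeasure P] (hm : m ≤ mΩ) {g f : Ω → ℝ} (hg : AEStronglyMeasurable g P)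
    {C : ℝ} (hgC : ∀ᵐ ω ∂P, |g ω| ≤ C) (hf : Integrable f P) :
    ∫ ω, P[g|m] ω * f ω ∂P = ∫ ω, g ω * P[f|m] ω ∂P := by
  have hgi : Integrable g P := Integrable.of_bound hg C hgC
  have hC : ∀ᵐ ω ∂P, ‖P[g|m] ω‖ ≤ C := ae_bdd_abs_condExp_of_ae_bdd_abs hgC
  have hi1 : Integrable (P[g|m] * f) P :=
    hf.bdd_mul integrable_condExp.aestronglyMeasurable hC
  have hi2 : Integrable (g * P[f|m]) P := integrable_condExp.bdd_mul hg hgC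
  have h1 := condExp_mul_of_stronglyMeasurable_left (μ := P) (m := m)
    stronglyMeasurable_condExp hi1 hf
  have h2 := condExp_mul_of_stronglyMeasurable_right (μ := P) (m := m)
    stronglyMeasurable_condExp hi2 hgi
  calc ∫ ω, P[g|m] ω * f ω ∂P = ∫ ω, (P[P[g|m] * f|m]) ω ∂P := (integral_condExp hm).symm
    _ = ∫ ω, (P[g * P[f|m]|m]) ω ∂P := integral_congr_ae (h1.trans h2.symm)
    _ = _ := integral_condExp hm

theorem integrable_prod_of_slice_bound {K Ω : Type*} [MeasurableSpace K]
    {mΩ : MeasurableSpace Ω} {P : Measure Ω} [IsProbabilityMeasure P] {κ : Measure K}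
    [IsProbabilityMeasure κ] {f : K → Ω → ℝ} (hf : Measurable fun p : K × Ω => f p.1 p.2)
    {C : ℝ} (hC : ∀ k, ∀ᵐ ω ∂P, |f k ω| ≤ C) :
    Integrable (fun p : K × Ω => f p.1 p.2) (κ.prod P) := by
  refine Integrable.of_bound hf.aestronglyMeasurable C ?_
  rw [Measure.ae_prod_iff_ae_ae (measurableSet_le hf.norm measurable_const)]
  exact Filter.Eventually.of_forall hC

/-- An average of processes that are adapted for each parameter separately is almost surely
adapted. -/
theorem condExp_integral_ae_eq {K Ω : Type*} [MeasurableSpace K] {m mΩ : MeasurableSpace Ω}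
    (hm : m ≤ mΩ) {P : Measure Ω} [IsProbabilityMeasure P] {κ : Measure K}
    [IsProbabilityMeasure κ] {f : K → Ω → ℝ} (hf : Measurable fun p : K × Ω => f p.1 p.2)
    {C : ℝ} (hC : ∀ k, ∀ᵐ ω ∂P, |f k ω| ≤ C) (hfm : ∀ k, AEStronglyMeasurable[m] (f k) P) :
    P[fun ω => ∫ k, f k ω ∂κ|m] =ᵐ[P] fun ω => ∫ k, f k ω ∂κ := by
  have hint := integrable_prod_of_slice_bound (κ := κ) hf hC
  have hY : Integrable (fun ω => ∫ k, f k ω ∂κ) P := hint.integral_prod_right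
  -- `A` ranges over all measurable sets, not only those of `m`. Self-adjointness moves the
  -- conditional expectation onto the indicator, Fubini reaches the slices, and each slice is fixed
  -- by conditioning.
  refine Integrable.ae_eq_of_forall_setIntegral_eq _ _ integrable_condExp hY fun A hA _ => ?_
  have hfi : ∀ k, Integrable (f k) P := fun k =>
    Integrable.of_bound (hf.comp measurable_prodMk_left).aestronglyMeasurable C (hC k)
  have hg : Measurable (A.indicator fun _ => (1 : ℝ)) := measurable_const.indicator hA
  have hgC : ∀ᵐ ω ∂P, |A.indicator (fun _ => (1 : ℝ)) ω| ≤ 1 :=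
    Filter.Eventually.of_forall fun ω => by
      by_cases h : ω ∈ A <;> simp [h]
  set g := A.indicator fun _ => (1 : ℝ) with hgdef
  have hset : ∀ φ : Ω → ℝ, ∫ ω in A, φ ω ∂P = ∫ ω, g ω * φ ω ∂P := by
    intro φ
    rw [← integral_indicator hA]
    congr 1
    ext ω
    by_cases h : ω ∈ A <;> simp [hgdef, h]
  have hswap : ∀ φ : Ω → ℝ, AEStronglyMeasurable φ P → (∀ᵐ ω ∂P, ‖φ ω‖ ≤ 1) →
      ∫ ω, φ ω * ∫ k, f k ω ∂κ ∂P = ∫ k, ∫ ω, φ ω * f k ω ∂P ∂κ := by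
    intro φ hφ hφ1
    simp_rw [← integral_const_mul]
    rw [integral_integral_swap]
    have h1 : Integrable (fun p : K × Ω => φ p.2 * f p.1 p.2) (κ.prod P) := by
      refine hint.bdd_mul (c := 1) hφ.comp_snd ?_
      exact Measure.quasiMeasurePreserving_snd.ae hφ1
    exact h1.swap
  have hgm : ∀ᵐ ω ∂P, ‖P[g|m] ω‖ ≤ 1 := ae_bdd_abs_condExp_of_ae_bdd_abs hgC
  rw [hset, hset, ← integral_condExp_mul_eq hm hg.aestronglyMeasurable hgC hY,
    hswap _ integrable_condExp.aestronglyMeasurable hgm, hswap _ hg.aestronglyMeasurable hgC]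
  congr 1
  ext k
  rw [integral_condExp_mul_eq hm hg.aestronglyMeasurable hgC (hfi k)]
  refine integral_congr_ae ?_
  filter_upwards [condExp_of_aestronglyMeasurable' hm (hfm k) (hfi k)] with ω h
  rw [h]

theorem ville_mixture {K Ω : Type*} [MeasurableSpace K] {mΩ : MeasurableSpace Ω}
    {P : Measure Ω} [IsProbabilityMeasure P] {F : Filtration ℕ mΩ} (κ : Measure K)
    [IsProbabilityMeasure κ] {X : ℕ → K → Ω → ℝ}
    (hX : ∀ t, Measurable fun p : K × Ω => X t p.1 p.2) (hnn : ∀ t k ω, 0 ≤ X t k ω)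
    {C : ℕ → ℝ} (hC : ∀ t k, ∀ᵐ ω ∂P, |X t k ω| ≤ C t)
    (hXm : ∀ t k, AEStronglyMeasurable[F t] (X t k) P)
    (hsuper : ∀ t k (A : Set Ω), MeasurableSet[F t] A →
      ∫ ω in A, X (t + 1) k ω ∂P ≤ ∫ ω in A, X t k ω ∂P)
    (hzero : ∀ k, ∀ᵐ ω ∂P, X 0 k ω = 1) {c : ℝ} (hc : 0 < c) :
    P {ω | ∃ t, c ≤ ∫ k, X t k ω ∂κ} ≤ ENNReal.ofReal (1 / c) := by
  have hint := fun t => integrable_prod_of_slice_bound (κ := κ) (hX t) (hC t)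
  have hY : ∀ t, Integrable (fun ω => ∫ k, X t k ω ∂κ) P := fun t => (hint t).integral_prod_right
  set Y : ℕ → Ω → ℝ := fun t ω => ∫ k, X t k ω ∂κ with hYdef
  have hZ : ∀ t, P[Y t|F t] =ᵐ[P] Y t := fun t =>
    condExp_integral_ae_eq (F.le t) (hX t) (hC t) (hXm t)
  have hfub : ∀ t (A : Set Ω), ∫ ω in A, Y t ω ∂P = ∫ k, ∫ ω in A, X t k ω ∂P ∂κ := by
    intro t A
    have h1 : Integrable (fun p : K × Ω => X t p.1 p.2) (κ.prod (P.restrict A)) :=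
      (hint t).mono_measure (Measure.prod_mono le_rfl Measure.restrict_le_self)
    exact (integral_integral_swap h1).symm
  -- The average itself need not be adapted; this adapted version agrees with it almost surely.
  have hsm : Supermartingale (fun t => P[Y t|F t]) F P := by
    refine supermartingale_of_setIntegral_succ_le (fun t => stronglyMeasurable_condExp)
      (fun t => integrable_condExp) fun t A hA => ?_
    rw [setIntegral_congr_ae (F.le t _ hA) ((hZ (t + 1)).mono fun ω h _ => h),
      setIntegral_congr_ae (F.le t _ hA) ((hZ t).mono fun ω h _ => h), hfub, hfub]
    have hi : ∀ s, Integrable (fun k => ∫ ω in A, X s k ω ∂P) κ := fun s =>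
      Integrable.integral_prod_left (f := fun p : K × Ω => X s p.1 p.2)
        ((hint s).mono_measure (Measure.prod_mono le_rfl Measure.restrict_le_self))
    exact integral_mono (hi _) (hi _) fun k => hsuper t k A hA
  have h := Supermartingale.ville hsm (fun n => (hZ n).mono fun ω h => by
    rw [h]; exact integral_nonneg fun k => hnn n k ω) hc
  have h0 : ∫ ω, P[Y 0|F 0] ω ∂P = 1 := by
    rw [integral_condExp (F.le 0), ← setIntegral_univ, hfub]
    have : ∀ k, ∫ ω in Set.univ, X 0 k ω ∂P = 1 := fun k => by
      rw [setIntegral_univ, integral_congr_ae (hzero k)]; simp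
    simp_rw [this]
    simp
  rw [h0] at h
  refine le_trans (measure_mono_ae ?_) h
  filter_upwards [ae_all_iff.2 hZ] with ω hω
  rintro ⟨t, ht⟩
  exact ⟨t, by rw [hω t]; exact ht⟩

/-! ### The Bernstein supermartingale inequality for one index. -/

section FixedIndex

variable {Ω : Type*} {mΩ : MeasurableSpace Ω} {P : Measure Ω}
  {F : Filtration ℕ mΩ} {N W : ℕ → Ω → ℝ} {b : ℝ}

theorem ae_abs_le_of_increment_bound (hN0 : ∀ᵐ ω ∂P, N 0 ω = 0)
    (hb : ∀ᵐ ω ∂P, ∀ t : ℕ, 1 ≤ t → |N t ω - N (t - 1) ω| ≤ b) :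
    ∀ᵐ ω ∂P, ∀ t : ℕ, |N t ω| ≤ t * b := by
  filter_upwards [hN0, hb] with ω h0 hb t
  induction t with
  | zero => simp [h0]
  | succ t ih =>
    have h1 := hb (t + 1) (Nat.le_add_left 1 t)
    have h2 := abs_add_le (N (t + 1) ω - N t ω) (N t ω)
    simp only [Nat.add_sub_cancel, sub_add_cancel] at h1 h2
    push_cast
    linarith

theorem ae_abs_increment_sq_le
    (hb : ∀ᵐ ω ∂P, ∀ t : ℕ, 1 ≤ t → |N t ω - N (t - 1) ω| ≤ b) (t : ℕ) :
    ∀ᵐ ω ∂P, |(N (t + 1) ω - N t ω) ^ 2| ≤ b ^ 2 := by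
  filter_upwards [hb] with ω hb
  have h1 := hb (t + 1) (Nat.le_add_left 1 t)
  rw [Nat.add_sub_cancel] at h1
  rw [abs_pow]
  gcongr

theorem ae_condVariance_succ
    (hW : ∀ t, W t =ᵐ[P] fun ω => ∑ i ∈ Finset.Icc 1 t,
      (P[fun ω' => (N i ω' - N (i - 1) ω') ^ 2 | F (i - 1)]) ω) :
    ∀ᵐ ω ∂P, W 0 ω = 0 ∧ ∀ t, W (t + 1) ω =
      W t ω + (P[fun ω' => (N (t + 1) ω' - N t ω') ^ 2 | F t]) ω := by
  filter_upwards [ae_all_iff.2 hW] with ω h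
  refine ⟨by rw [h 0]; simp, fun t => ?_⟩
  rw [h (t + 1), h t, Finset.sum_Icc_succ_top (Nat.le_add_left 1 t)]
  simp

theorem ae_condVariance_bounds [IsProbabilityMeasure P]
    (hb : ∀ᵐ ω ∂P, ∀ t : ℕ, 1 ≤ t → |N t ω - N (t - 1) ω| ≤ b)
    (hW : ∀ t, W t =ᵐ[P] fun ω => ∑ i ∈ Finset.Icc 1 t,
      (P[fun ω' => (N i ω' - N (i - 1) ω') ^ 2 | F (i - 1)]) ω) :
    ∀ᵐ ω ∂P, ∀ t : ℕ, 0 ≤ W t ω ∧ W t ω ≤ t * b ^ 2 ∧ W t ω ≤ W (t + 1) ω := by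
  have hv : ∀ᵐ ω ∂P, ∀ t : ℕ,
      0 ≤ (P[fun ω' => (N (t + 1) ω' - N t ω') ^ 2 | F t]) ω ∧
      (P[fun ω' => (N (t + 1) ω' - N t ω') ^ 2 | F t]) ω ≤ b ^ 2 := by
    refine ae_all_iff.2 fun t => ?_
    have h1 : 0 ≤ᵐ[P] P[fun ω' => (N (t + 1) ω' - N t ω') ^ 2 | F t] :=
      condExp_nonneg (Filter.Eventually.of_forall fun ω => sq_nonneg _)
    have h2 := ae_bdd_abs_condExp_of_ae_bdd_abs (m := F t) (ae_abs_increment_sq_le hb t)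
    filter_upwards [h1, h2] with ω h1 h2
    exact ⟨h1, (le_abs_self _).trans h2⟩
  filter_upwards [hv, ae_condVariance_succ hW] with ω hv ⟨h0, hs⟩
  have hle : ∀ t : ℕ, 0 ≤ W t ω ∧ W t ω ≤ t * b ^ 2 := by
    intro t
    induction t with
    | zero => simp [h0]
    | succ t ih =>
      rw [hs t]
      push_cast
      constructor <;> linarith [(hv t).1, (hv t).2, ih.1, ih.2]
  exact fun t => ⟨(hle t).1, (hle t).2, by rw [hs t]; linarith [(hv t).1]⟩

/-- The exponential process `exp (l N - l² (e - 2) W)`. -/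
noncomputable def bernsteinExp (l n w : ℝ) : ℝ :=
  Real.exp (l * n - l ^ 2 * ((Real.exp 1 - 2) * w))

theorem exp_one_sub_two_pos : 0 < Real.exp 1 - 2 := by
  have := Real.exp_one_gt_d9; linarith

theorem ae_bernsteinExp_le [IsProbabilityMeasure P] {l : ℝ} (hl : |l| * b ≤ 1)
    (hN0 : ∀ᵐ ω ∂P, N 0 ω = 0)
    (hb : ∀ᵐ ω ∂P, ∀ t : ℕ, 1 ≤ t → |N t ω - N (t - 1) ω| ≤ b)
    (hW : ∀ t, W t =ᵐ[P] fun ω => ∑ i ∈ Finset.Icc 1 t,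
      (P[fun ω' => (N i ω' - N (i - 1) ω') ^ 2 | F (i - 1)]) ω) :
    ∀ᵐ ω ∂P, ∀ t : ℕ, |bernsteinExp l (N t ω) (W t ω)| ≤ Real.exp t := by
  filter_upwards [ae_abs_le_of_increment_bound hN0 hb, ae_condVariance_bounds hb hW]
    with ω h1 h2 t
  rw [bernsteinExp, abs_of_pos (Real.exp_pos _)]
  refine Real.exp_le_exp.2 ?_
  have h3 : l * N t ω ≤ t * (|l| * b) := by
    calc l * N t ω ≤ |l * N t ω| := le_abs_self _
      _ = |l| * |N t ω| := abs_mul _ _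
      _ ≤ |l| * (t * b) := by gcongr; exact h1 t
      _ = _ := by ring
  have h4 : (t : ℝ) * (|l| * b) ≤ t * 1 := by gcongr
  have h5 : 0 ≤ l ^ 2 * ((Real.exp 1 - 2) * W t ω) :=
    mul_nonneg (sq_nonneg _) (mul_nonneg exp_one_sub_two_pos.le (h2 t).1)
  linarith

theorem aestronglyMeasurable_bernsteinExp (l : ℝ) (hN : Martingale N F P)
    (hW : ∀ t, W t =ᵐ[P] fun ω => ∑ i ∈ Finset.Icc 1 t,
      (P[fun ω' => (N i ω' - N (i - 1) ω') ^ 2 | F (i - 1)]) ω) (t : ℕ) :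
    AEStronglyMeasurable[F t] (fun ω => bernsteinExp l (N t ω) (W t ω)) P := by
  have hs : StronglyMeasurable[F t] fun ω => ∑ i ∈ Finset.Icc 1 t,
      (P[fun ω' => (N i ω' - N (i - 1) ω') ^ 2 | F (i - 1)]) ω := by
    refine Finset.stronglyMeasurable_fun_sum _ fun i hi => ?_
    exact stronglyMeasurable_condExp.mono (F.mono (by
      have := (Finset.mem_Icc.1 hi).2; omega))
  have hX := Real.continuous_exp.comp_stronglyMeasurable
    (((hN.1 t).const_mul l).sub ((hs.const_mul (Real.exp 1 - 2)).const_mul (l ^ 2)))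
  refine ⟨_, hX, ?_⟩
  filter_upwards [hW t] with ω h
  simp [bernsteinExp, h]

/-- The conditional mean of `exp (l ξ)` is at most `1 + l² (e - 2) v ≤ exp (l² (e - 2) v)`, which
the growth of `W` cancels. Set integrals are used because `W` is adapted only up to null sets and
because they commute with averaging. -/
theorem setIntegral_bernsteinExp_succ_le [IsProbabilityMeasure P] {l : ℝ} (hl : |l| * b ≤ 1)
    (hN : Martingale N F P)
    (hN0 : ∀ᵐ ω ∂P, N 0 ω = 0)
    (hb : ∀ᵐ ω ∂P, ∀ t : ℕ, 1 ≤ t → |N t ω - N (t - 1) ω| ≤ b)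
    (hW : ∀ t, W t =ᵐ[P] fun ω => ∑ i ∈ Finset.Icc 1 t,
      (P[fun ω' => (N i ω' - N (i - 1) ω') ^ 2 | F (i - 1)]) ω)
    (t : ℕ) {A : Set Ω} (hA : MeasurableSet[F t] A) :
    ∫ ω in A, bernsteinExp l (N (t + 1) ω) (W (t + 1) ω) ∂P ≤
      ∫ ω in A, bernsteinExp l (N t ω) (W t ω) ∂P := by
  have hc := exp_one_sub_two_pos
  set c := Real.exp 1 - 2 with hcdef
  set ξ : Ω → ℝ := fun ω => N (t + 1) ω - N t ω with hξ
  set v : Ω → ℝ := P[fun ω => ξ ω ^ 2|F t] with hv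
  have hξi : Integrable ξ P := (hN.integrable _).sub (hN.integrable _)
  have hξm : AEStronglyMeasurable ξ P := hξi.aestronglyMeasurable
  have hξb : ∀ᵐ ω ∂P, |l * ξ ω| ≤ 1 := by
    filter_upwards [hb] with ω h
    have h1 := h (t + 1) (Nat.le_add_left 1 t)
    rw [Nat.add_sub_cancel] at h1
    rw [abs_mul]
    exact (mul_le_mul_of_nonneg_left h1 (abs_nonneg l)).trans hl
  have hξ2i : Integrable (fun ω => ξ ω ^ 2) P :=
    Integrable.of_bound (hξm.pow 2) (b ^ 2) (ae_abs_increment_sq_le hb t)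
  have hv0 : 0 ≤ᵐ[P] v := condExp_nonneg (Filter.Eventually.of_forall fun ω => sq_nonneg _)
  have hEm : AEStronglyMeasurable (fun ω => Real.exp (l * ξ ω)) P :=
    Real.continuous_exp.comp_aestronglyMeasurable (hξm.const_mul l)
  have hEi : Integrable (fun ω => Real.exp (l * ξ ω)) P := by
    refine Integrable.of_bound hEm (Real.exp 1) ?_
    filter_upwards [hξb] with ω h
    rw [Real.norm_eq_abs, Real.abs_exp]
    exact Real.exp_le_exp.2 ((le_abs_self _).trans h)
  have hξ0 : P[ξ|F t] =ᵐ[P] 0 := by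
    have h1 := condExp_sub (hN.integrable (t + 1)) (hN.integrable t) (F t)
    filter_upwards [h1, hN.2 t (t + 1) t.le_succ, hN.2 t t le_rfl] with ω h1 h2 h3
    have : P[ξ|F t] ω = (P[N (t + 1) - N t|F t]) ω := rfl
    rw [this, h1, Pi.sub_apply, h2, h3]
    simp
  have hEle : ∀ᵐ ω ∂P, (P[fun ω => Real.exp (l * ξ ω)|F t]) ω ≤
      Real.exp (l ^ 2 * (c * v ω)) := by
    have hi1 : Integrable (l • ξ) P := hξi.smul l
    have hi2 : Integrable ((l ^ 2 * c) • fun ω => ξ ω ^ 2) P := hξ2i.smul _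
    have hi0 : Integrable (fun _ : Ω => (1 : ℝ)) P := integrable_const 1
    have hmono : P[fun ω => Real.exp (l * ξ ω)|F t] ≤ᵐ[P]
        P[((fun _ => (1 : ℝ)) + l • ξ) + (l ^ 2 * c) • fun ω => ξ ω ^ 2|F t] := by
      refine condExp_mono hEi ((hi0.add hi1).add hi2) ?_
      filter_upwards [hξb] with ω h
      have := exp_le_one_add_add_sq h
      simp only [Pi.add_apply, Pi.smul_apply, smul_eq_mul]
      calc _ ≤ _ := this
        _ = _ := by rw [hcdef]; ring
    have e1 := condExp_add (hi0.add hi1) hi2 (F t)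
    have e2 := condExp_add hi0 hi1 (F t)
    have e3 := condExp_smul (μ := P) l ξ (F t)
    have e4 := condExp_smul (μ := P) (l ^ 2 * c) (fun ω => ξ ω ^ 2) (F t)
    filter_upwards [hmono, e1, e2, e3, e4, hξ0] with ω hm e1 e2 e3 e4 h0
    refine hm.trans ?_
    rw [e1, Pi.add_apply, e2, Pi.add_apply, e3, e4, condExp_const (F.le t)]
    simp only [Pi.smul_apply, smul_eq_mul, h0, Pi.zero_apply, mul_zero, add_zero]
    have := Real.add_one_le_exp (l ^ 2 * (c * v ω))
    rw [mul_assoc]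
    linarith
  -- The next compensator increment is already known at time `t`, so it joins the factor pulled out
  -- of the conditional expectation.
  set D : Ω → ℝ := fun ω => bernsteinExp l (N t ω) (W t ω) * Real.exp (-(l ^ 2 * (c * v ω)))
    with hD
  have hXb := ae_bernsteinExp_le hl hN0 hb hW
  have hvm : StronglyMeasurable[F t] v := stronglyMeasurable_condExp
  have hDm : AEStronglyMeasurable[F t] D P :=
    (aestronglyMeasurable_bernsteinExp l hN hW t).mul
      (Real.continuous_exp.comp_stronglyMeasurable
        ((hvm.const_mul c).const_mul (l ^ 2)).neg).aestronglyMeasurable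
  have hDb : ∀ᵐ ω ∂P, ‖D ω‖ ≤ Real.exp t := by
    filter_upwards [hXb, hv0] with ω h1 h2
    have h2 : 0 ≤ v ω := h2
    rw [hD, norm_mul, Real.norm_eq_abs, Real.norm_eq_abs, Real.abs_exp]
    have : Real.exp (-(l ^ 2 * (c * v ω))) ≤ 1 := Real.exp_le_one_iff.2 (by
      have : 0 ≤ l ^ 2 * (c * v ω) := by positivity
      linarith)
    calc _ ≤ Real.exp t * 1 := by gcongr; exact h1 t
      _ = _ := mul_one _
  have hXeq : (fun ω => bernsteinExp l (N (t + 1) ω) (W (t + 1) ω)) =ᵐ[P]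
      D * fun ω => Real.exp (l * ξ ω) := by
    filter_upwards [ae_condVariance_succ hW] with ω h
    rw [h.2 t]
    simp only [hD, bernsteinExp, Pi.mul_apply, ← Real.exp_add]
    congr 1
    simp only [hξ, hv]
    ring
  have hpull := condExp_stronglyMeasurable_mul_of_bound₀ (F.le t) hDm hEi _ hDb
  have hDmΩ : AEStronglyMeasurable D P := hDm.mono (F.le t)
  have hDEi : Integrable (D * fun ω => Real.exp (l * ξ ω)) P := hEi.bdd_mul hDmΩ hDb
  have hXi : Integrable (fun ω => bernsteinExp l (N t ω) (W t ω)) P :=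
    Integrable.of_bound ((aestronglyMeasurable_bernsteinExp l hN hW t).mono (F.le t)) _
      (hXb.mono fun ω h => h t)
  rw [setIntegral_congr_ae (F.le t _ hA) (hXeq.mono fun ω h _ => h),
    ← setIntegral_condExp (F.le t) hDEi hA]
  refine setIntegral_mono_ae integrable_condExp.integrableOn hXi.integrableOn ?_
  filter_upwards [hpull, hEle] with ω h1 h2
  rw [h1, Pi.mul_apply]
  have hDnn : 0 ≤ D ω := mul_nonneg (Real.exp_pos _).le (Real.exp_pos _).le
  calc D ω * _ ≤ D ω * Real.exp (l ^ 2 * (c * v ω)) := mul_le_mul_of_nonneg_left h2 hDnn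
    _ = _ := by
      simp only [hD]
      rw [mul_assoc, ← Real.exp_add, neg_add_cancel, Real.exp_zero, mul_one]

end FixedIndex

/-! ### Mixing over the index and the parameter, and change of measure. -/

theorem abs_mul_exp_sq_le_one {l : ℝ} (hl : |l| ≤ Real.exp (-2)) : |l| * Real.exp 1 ^ 2 ≤ 1 := by
  have h : Real.exp (-2) * Real.exp 1 ^ 2 = 1 := by
    rw [← Real.exp_nat_mul, ← Real.exp_add]; simp
  calc _ ≤ Real.exp (-2) * Real.exp 1 ^ 2 := by gcongr
    _ = 1 := h

theorem measurable_bernsteinExp {α : Type*} [MeasurableSpace α] {l n w : α → ℝ}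
    (hl : Measurable l) (hn : Measurable n) (hw : Measurable w) :
    Measurable fun a => bernsteinExp (l a) (n a) (w a) :=
  Real.measurable_exp.comp ((hl.mul hn).sub ((hl.pow_const 2).mul (hw.const_mul _)))

theorem measure_exists_le_integral_bernsteinExp {Ω H L : Type*} {mΩ : MeasurableSpace Ω}
    [MeasurableSpace H] [MeasurableSpace L]
    (P : Measure Ω) [IsProbabilityMeasure P] (F : Filtration ℕ mΩ)
    (M V : ℕ → H → Ω → ℝ)
    (hM_meas : ∀ t : ℕ, Measurable (fun p : H × Ω => M t p.1 p.2))
    (hM_mart : ∀ h : H, Martingale (fun t => M t h) F P)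
    (hM_zero : ∀ h : H, ∀ᵐ ω ∂P, M 0 h ω = 0)
    (hM_bdd : ∀ h : H, ∀ᵐ ω ∂P, ∀ t : ℕ, 1 ≤ t →
      |M t h ω - M (t - 1) h ω| ≤ Real.exp 1 ^ 2)
    (hV : IsCondVariance P F M V)
    (prior : Measure H) [IsProbabilityMeasure prior]
    (μ : Measure L) [IsProbabilityMeasure μ] {ℓ : L → ℝ} (hℓ : Measurable ℓ)
    (hℓb : ∀ u, |ℓ u| ≤ Real.exp (-2)) {c : ℝ} (hc : 0 < c) :
    P {ω | ∃ t, c ≤ ∫ k : L × H, bernsteinExp (ℓ k.1) (M t k.2 ω) (V t k.2 ω) ∂(μ.prod prior)} ≤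
      ENNReal.ofReal (1 / c) := by
  have hl : ∀ u, |ℓ u| * Real.exp 1 ^ 2 ≤ 1 := fun u => abs_mul_exp_sq_le_one (hℓb u)
  have hW : ∀ h t, V t h =ᵐ[P] fun ω => ∑ i ∈ Finset.Icc 1 t,
      (P[fun ω' => (M i h ω' - M (i - 1) h ω') ^ 2 | F (i - 1)]) ω := fun h t => hV.ae_eq t h
  refine ville_mixture (F := F) (μ.prod prior)
    (X := fun t k ω => bernsteinExp (ℓ k.1) (M t k.2 ω) (V t k.2 ω))
    (fun t => ?_) (fun t k ω => (Real.exp_pos _).le) (C := fun t => Real.exp t)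
    (fun t k => ?_) (fun t k => ?_) (fun t k A hA => ?_) (fun k => ?_) hc
  · have hp : Measurable fun p : (L × H) × Ω => (p.1.2, p.2) := by fun_prop
    exact measurable_bernsteinExp (hℓ.comp (measurable_fst.comp measurable_fst))
      ((hM_meas t).comp hp) ((hV.measurable t).comp hp)
  · exact (ae_bernsteinExp_le (hl k.1) (hM_zero k.2) (hM_bdd k.2) (hW k.2)).mono fun ω h => h t
  · exact aestronglyMeasurable_bernsteinExp _ (hM_mart k.2) (hW k.2) t
  · exact setIntegral_bernsteinExp_succ_le (hl k.1) (hM_mart k.2) (hM_zero k.2) (hM_bdd k.2)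
      (hW k.2) t hA
  · filter_upwards [hM_zero k.2, ae_condVariance_succ (hW k.2)] with ω h1 h2
    simp [bernsteinExp, h1, h2.1]

/-- Fubini exchanges the quantifiers, turning a null set of outcomes for each index into a single
null set of outcomes. Finite divergence later carries the bounds from the prior to `ρ`. -/
theorem ae_ae_regular {Ω H : Type*} {mΩ : MeasurableSpace Ω} [MeasurableSpace H]
    (P : Measure Ω) [IsProbabilityMeasure P] (F : Filtration ℕ mΩ)
    (M V : ℕ → H → Ω → ℝ)
    (hM_meas : ∀ t : ℕ, Measurable (fun p : H × Ω => M t p.1 p.2))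
    (hM_zero : ∀ h : H, ∀ᵐ ω ∂P, M 0 h ω = 0)
    (hM_bdd : ∀ h : H, ∀ᵐ ω ∂P, ∀ t : ℕ, 1 ≤ t →
      |M t h ω - M (t - 1) h ω| ≤ Real.exp 1 ^ 2)
    (hV : IsCondVariance P F M V)
    (prior : Measure H) [IsProbabilityMeasure prior] :
    ∀ᵐ ω ∂P, ∀ t : ℕ, ∀ᵐ h ∂prior, |M t h ω| ≤ t * Real.exp 1 ^ 2 ∧ 0 ≤ V t h ω ∧
      V t h ω ≤ t * (Real.exp 1 ^ 2) ^ 2 ∧ V t h ω ≤ V (t + 1) h ω := by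
  refine ae_all_iff.2 fun t => ?_
  have hm := hM_meas t
  have hv := hV.measurable t
  have hms : MeasurableSet {p : H × Ω | |M t p.1 p.2| ≤ t * Real.exp 1 ^ 2 ∧ 0 ≤ V t p.1 p.2 ∧
      V t p.1 p.2 ≤ t * (Real.exp 1 ^ 2) ^ 2 ∧ V t p.1 p.2 ≤ V (t + 1) p.1 p.2} :=
    (measurableSet_le hm.norm measurable_const).inter
      ((measurableSet_le measurable_const hv).inter
        ((measurableSet_le hv measurable_const).inter
          (measurableSet_le hv (hV.measurable (t + 1)))))
  refine (Measure.ae_ae_comm (μ := prior) (ν := P) hms).1 (Filter.Eventually.of_forall fun h => ?_)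
  filter_upwards [ae_abs_le_of_increment_bound (hM_zero h) (hM_bdd h),
    ae_condVariance_bounds (hM_bdd h) fun t => hV.ae_eq t h] with ω h1 h2
  exact ⟨h1 t, h2 t⟩

theorem bernsteinExp_le_exp {l n w B : ℝ} (hl : |l| ≤ Real.exp (-2)) (hn : |n| ≤ B)
    (hw : 0 ≤ w) : bernsteinExp l n w ≤ Real.exp B := by
  refine Real.exp_le_exp.2 ?_
  have h1 : |l| ≤ 1 := hl.trans (Real.exp_le_one_iff.2 (by norm_num))
  have h2 : l * n ≤ 1 * B := (le_abs_self _).trans (by rw [abs_mul]; gcongr)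
  have h3 : 0 ≤ l ^ 2 * ((Real.exp 1 - 2) * w) :=
    mul_nonneg (sq_nonneg _) (mul_nonneg exp_one_sub_two_pos.le hw)
  linarith

theorem integrable_bernsteinExp {L : Type*} [MeasurableSpace L] {μ : Measure L}
    [IsProbabilityMeasure μ] {l n w : L → ℝ} {B : ℝ} (hl : Measurable l) (hn : Measurable n)
    (hw : Measurable w) (hb : ∀ᵐ u ∂μ, |l u| ≤ Real.exp (-2) ∧ |n u| ≤ B ∧ 0 ≤ w u) :
    Integrable (fun u => bernsteinExp (l u) (n u) (w u)) μ := by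
  refine Integrable.of_bound (measurable_bernsteinExp hl hn hw).aestronglyMeasurable (Real.exp B) ?_
  filter_upwards [hb] with u h
  rw [bernsteinExp, Real.norm_eq_abs, Real.abs_exp]
  exact bernsteinExp_le_exp h.1 h.2.1 h.2.2

/-- Change of measure for a mixture of Bernstein exponentials. -/
theorem integral_bernsteinExp_mean_le {H L : Type*} [MeasurableSpace H] [MeasurableSpace L]
    {prior ρ : Measure H} [IsProbabilityMeasure prior] [IsProbabilityMeasure ρ]
    (hkl : InformationTheory.klDiv ρ prior ≠ ⊤)
    (μ : Measure L) [IsProbabilityMeasure μ] {ℓ : L → ℝ} (hℓ : Measurable ℓ)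
    (hℓb : ∀ u, |ℓ u| ≤ Real.exp (-2)) {n w : H → ℝ} (hn : Measurable n) (hw : Measurable w)
    {B : ℝ} (hb : ∀ᵐ h ∂prior, |n h| ≤ B ∧ 0 ≤ w h)
    (hnρ : Integrable n ρ) (hwρ : Integrable w ρ) :
    ∫ u, bernsteinExp (ℓ u) (∫ h, n h ∂ρ) (∫ h, w h ∂ρ) ∂μ ≤
      Real.exp (InformationTheory.klDiv ρ prior).toReal *
        ∫ k : L × H, bernsteinExp (ℓ k.1) (n k.2) (w k.2) ∂(μ.prod prior) := by
  have hac := (InformationTheory.klDiv_ne_top_iff.1 hkl).1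
  have hprod : Integrable (fun k : L × H => bernsteinExp (ℓ k.1) (n k.2) (w k.2))
      (μ.prod prior) := by
    refine integrable_bernsteinExp (B := B) (hℓ.comp measurable_fst) (hn.comp measurable_snd)
      (hw.comp measurable_snd) ?_
    filter_upwards [Measure.quasiMeasurePreserving_snd.ae hb] with k h
    exact ⟨hℓb _, h⟩
  have hw0 : 0 ≤ ∫ h, w h ∂ρ := integral_nonneg_of_ae (by
    have hbρ : ∀ᵐ h ∂ρ, |n h| ≤ B ∧ 0 ≤ w h := hac.ae_le hb
    exact hbρ.mono fun h hh => hh.2)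
  rw [integral_prod _ hprod, ← integral_const_mul]
  refine integral_mono ?_ (hprod.integral_prod_left.const_mul _) fun u => ?_
  · exact integrable_bernsteinExp (B := |∫ h, n h ∂ρ|) hℓ measurable_const measurable_const
      (Filter.Eventually.of_forall fun u => ⟨hℓb u, le_rfl, hw0⟩)
  · have hf : Integrable (fun h => ℓ u * n h - ℓ u ^ 2 * ((Real.exp 1 - 2) * w h)) ρ :=
      (hnρ.const_mul _).sub ((hwρ.const_mul _).const_mul _)
    have hdv := exp_integral_sub_klDiv_le_integral_exp hkl hf
      (integrable_bernsteinExp (B := B) measurable_const hn hw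
        (hb.mono fun h hh => ⟨hℓb u, hh⟩))
    rw [integral_sub (hnρ.const_mul _) ((hwρ.const_mul _).const_mul _), integral_const_mul,
      integral_const_mul, integral_const_mul, Real.exp_sub, div_le_iff₀' (Real.exp_pos _)] at hdv
    exact hdv

/-! ### The heavy mixing law near zero. -/

/-- The tuning parameter `± exp (-1 / |u|)`; for `u` uniform on `[-1/2, 1/2]` it has density
`1 / (|l| (log |l|)²)` on `[-e⁻², e⁻²]`. -/
noncomputable def tuning (u : ℝ) : ℝ :=
  if 0 < u ∧ u ≤ 1 / 2 then Real.exp (-u⁻¹)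
  else if 0 < -u ∧ -u ≤ 1 / 2 then -Real.exp (-(-u)⁻¹) else 0

theorem measurable_tuning : Measurable tuning := by
  unfold tuning
  refine Measurable.ite ?_ ?_ (Measurable.ite ?_ ?_ measurable_const)
  · exact (measurableSet_lt measurable_const measurable_id).inter
      (measurableSet_le measurable_id measurable_const)
  · fun_prop
  · exact (measurableSet_lt measurable_const measurable_neg).inter
      (measurableSet_le measurable_neg measurable_const)
  · fun_prop

theorem abs_tuning_le (u : ℝ) : |tuning u| ≤ Real.exp (-2) := by
  have key : ∀ v : ℝ, 0 < v → v ≤ 1 / 2 → Real.exp (-v⁻¹) ≤ Real.exp (-2) := by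
    intro v h0 h1
    refine Real.exp_le_exp.2 (neg_le_neg ?_)
    rw [le_inv_comm₀ two_pos h0]
    linarith
  unfold tuning
  split_ifs with h1 h2
  · rw [Real.abs_exp]; exact key u h1.1 h1.2
  · rw [abs_neg, Real.abs_exp]; exact key _ h2.1 h2.2
  · simpa using (Real.exp_pos _).le

/-- The uniform distribution on `[-1/2, 1/2]`. -/
noncomputable def tuningLaw : Measure ℝ := volume.restrict (Set.Icc (-(1 / 2)) (1 / 2))

instance : IsProbabilityMeasure tuningLaw := ⟨by
  rw [tuningLaw, Measure.restrict_apply_univ, Real.volume_Icc]; norm_num⟩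

theorem mul_exp_le_integral_tuningLaw {f : ℝ → ℝ} (hf : Integrable (fun u => Real.exp (f u)) tuningLaw)
    {p q E : ℝ} (hpq : p ≤ q) (hp : -(1 / 2) ≤ p) (hq : q ≤ 1 / 2)
    (hE : ∀ u ∈ Set.Icc p q, E ≤ f u) :
    (q - p) * Real.exp E ≤ ∫ u, Real.exp (f u) ∂tuningLaw := by
  have hsub : Set.Icc p q ⊆ Set.Icc (-(1 / 2)) (1 / 2) := Set.Icc_subset_Icc hp hq
  have h1 : ∫ u in Set.Icc p q, Real.exp (f u) ≤ ∫ u, Real.exp (f u) ∂tuningLaw :=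
    setIntegral_mono_set hf (Filter.Eventually.of_forall fun u => (Real.exp_pos _).le)
      hsub.eventuallyLE
  refine le_trans ?_ h1
  have h2 := setIntegral_mono_on (μ := volume) (s := Set.Icc p q) (f := fun _ => Real.exp E)
    (g := fun u => Real.exp (f u)) (by simp) (IntegrableOn.mono_set hf hsub) measurableSet_Icc
    fun u hu => Real.exp_le_exp.2 (hE u hu)
  simpa [hpq] using h2

theorem lambda0_pos : 0 < lambda0 := by unfold lambda0; positivity

theorem lambda0_mul : lambda0 * (1 + Real.sqrt (1 / 3)) = Real.exp (-2) := by
  have : Real.exp (-2) = (Real.exp 1 ^ 2)⁻¹ := by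
    rw [← Real.exp_nat_mul, ← Real.exp_neg]; simp
  rw [this, lambda0]
  field_simp

theorem lambda0_le : lambda0 ≤ Real.exp (-2) := by
  rw [← lambda0_mul]
  exact le_mul_of_one_le_right lambda0_pos.le (by linarith [Real.sqrt_nonneg (1 / 3)])

/-- In `l = exp (-1/u)` the interval is `x (1 - r) ≤ l ≤ x (1 + r)` with `r = √(1/3)`, where `2 l x
- l² = x² - (l - x)² ≥ (2/3) x²`. -/
theorem exists_tuning_interval {x : ℝ} (hx : 0 < x) (hx' : x ≤ lambda0) :
    0 < Real.log (3 / (2 * x)) ∧ ∃ p q : ℝ, 0 < p ∧ q ≤ 1 / 2 ∧ p ≤ q ∧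
      1 / Real.log (3 / (2 * x)) ^ 2 ≤ q - p ∧
      ∀ u ∈ Set.Icc p q, x ^ 2 * 2 / 3 ≤ 2 * Real.exp (-u⁻¹) * x - Real.exp (-u⁻¹) ^ 2 := by
  set r := Real.sqrt (1 / 3) with hr
  have hr2 : r ^ 2 = 1 / 3 := Real.sq_sqrt (by norm_num)
  have hr0 : 0 ≤ r := Real.sqrt_nonneg _
  have hr1 : r < 1 := by nlinarith
  have hrl : (57 : ℝ) / 100 ≤ r := by
    rw [hr]; exact Real.le_sqrt_of_sq_le (by norm_num)
  have ha : 0 < x * (1 - r) := mul_pos hx (by linarith)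
  have hb : 0 < x * (1 + r) := by positivity
  set α := -Real.log (x * (1 + r)) with hα
  set β := -Real.log (x * (1 - r)) with hβ
  -- This is where `λ₀` is sharp: `λ₀ (1 + r) = e⁻²` keeps the interval inside `u ≤ 1/2`.
  have hα2 : 2 ≤ α := by
    have h1 : x * (1 + r) ≤ Real.exp (-2) := by rw [← lambda0_mul]; gcongr
    have := Real.log_le_log hb h1
    rw [Real.log_exp] at this
    linarith
  have hβα : 1 ≤ β - α := by
    have h1 : Real.exp 1 * (x * (1 - r)) ≤ x * (1 + r) := by
      have := Real.exp_one_lt_d9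
      have h2 : Real.exp 1 * (1 - r) ≤ 1 + r := by nlinarith
      nlinarith
    have := Real.log_le_log (by positivity) h1
    rw [Real.log_mul (Real.exp_pos _).ne' ha.ne', Real.log_exp] at this
    linarith
  have hα0 : 0 < α := by linarith
  have hβ0 : 0 < β := by linarith
  have hsum : α + β ≤ 2 * Real.log (3 / (2 * x)) := by
    have h1 : α + β = -Real.log (x * (1 + r) * (x * (1 - r))) := by
      rw [Real.log_mul hb.ne' ha.ne']; ring
    have h2 : 2 * Real.log (3 / (2 * x)) = -Real.log ((2 * x / 3) ^ 2) := by
      rw [Real.log_pow, ← inv_div, Real.log_inv]; push_cast; ring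
    rw [h1, h2]
    refine neg_le_neg (Real.log_le_log (by positivity) ?_)
    nlinarith [sq_nonneg x]
  have hlog : 0 < Real.log (3 / (2 * x)) := by linarith
  refine ⟨hlog, β⁻¹, α⁻¹, inv_pos.2 hβ0, ?_, ?_, ?_, ?_⟩
  · rw [one_div]; exact inv_anti₀ two_pos hα2
  · exact inv_anti₀ hα0 (by linarith)
  -- The length is `(β - α) / (α β)`, with numerator at least `1` and `α β ≤ ((α + β) / 2)²`.
  · rw [inv_sub_inv hα0.ne' hβ0.ne']
    refine div_le_div₀ (by linarith) hβα (by positivity) ?_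
    nlinarith [sq_nonneg (α - β)]
  · rintro u ⟨hu1, hu2⟩
    have hu0 : 0 < u := (inv_pos.2 hβ0).trans_le hu1
    have h1 : x * (1 - r) ≤ Real.exp (-u⁻¹) := by
      rw [← Real.log_le_iff_le_exp ha]
      have := inv_le_of_inv_le₀ hβ0 hu1
      linarith
    have h2 : Real.exp (-u⁻¹) ≤ x * (1 + r) := by
      rw [← Real.le_log_iff_exp_le hb]
      have := (le_inv_comm₀ hu0 hα0).1 hu2
      linarith
    have h3 : (Real.exp (-u⁻¹) - x) ^ 2 ≤ (x * r) ^ 2 :=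
      sq_le_sq' (by linarith) (by linarith)
    nlinarith

theorem exp_div_log_sq_le_integral_tuning {m U : ℝ} (hm : m ≠ 0) (hU : 0 < U)
    (hmU : |m| ≤ lambda0 * U) :
    0 < Real.log (3 * U / (2 * |m|)) ∧
    Real.exp (m ^ 2 / (3 * U)) / Real.log (3 * U / (2 * |m|)) ^ 2 ≤
      ∫ u, Real.exp (tuning u * m - tuning u ^ 2 * (U / 2)) ∂tuningLaw := by
  have hx : 0 < |m| / U := div_pos (abs_pos.2 hm) hU
  obtain ⟨hlog, p, q, hp, hq, hpq, hlen, hexp⟩ :=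
    exists_tuning_interval hx ((div_le_iff₀ hU).2 hmU)
  have heq : 3 / (2 * (|m| / U)) = 3 * U / (2 * |m|) := by field_simp
  rw [heq] at hlog hlen
  refine ⟨hlog, ?_⟩
  have hint : Integrable (fun u => Real.exp (tuning u * m - tuning u ^ 2 * (U / 2))) tuningLaw := by
    have := integrable_bernsteinExp (μ := tuningLaw) (B := |m|) (n := fun _ => m)
      (w := fun _ => U / 2 / (Real.exp 1 - 2)) measurable_tuning measurable_const measurable_const
      (Filter.Eventually.of_forall fun u => ⟨abs_tuning_le u, le_rfl,
        div_nonneg (by linarith) exp_one_sub_two_pos.le⟩)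
    simpa only [bernsteinExp, mul_div_cancel₀ _ exp_one_sub_two_pos.ne'] using this
  have hE : ∀ u ∈ Set.Icc p q,
      m ^ 2 / (3 * U) ≤ Real.exp (-u⁻¹) * |m| - Real.exp (-u⁻¹) ^ 2 * (U / 2) := by
    intro u hu
    have h := mul_le_mul_of_nonneg_right (hexp u hu) (half_pos hU).le
    calc m ^ 2 / (3 * U) = (|m| / U) ^ 2 * 2 / 3 * (U / 2) := by
          rw [← sq_abs]; field_simp
      _ ≤ _ := h
      _ = _ := by field_simp
  have hfinal : Real.exp (m ^ 2 / (3 * U)) / Real.log (3 * U / (2 * |m|)) ^ 2 ≤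
      (q - p) * Real.exp (m ^ 2 / (3 * U)) := by
    rw [div_eq_mul_one_div, mul_comm]
    gcongr
  refine hfinal.trans ?_
  rcases hm.lt_or_gt with hneg | hpos
  · have := mul_exp_le_integral_tuningLaw hint (p := -q) (q := -p) (E := m ^ 2 / (3 * U))
      (by linarith) (by linarith) (by linarith) fun u hu => by
        have hu' : -u ∈ Set.Icc p q := ⟨by linarith [hu.2], by linarith [hu.1]⟩
        have h0 : 0 < -u := hp.trans_le hu'.1
        have ht : tuning u = -Real.exp (-(-u)⁻¹) := by
          rw [tuning, if_neg (fun h => by linarith [h.1]), if_pos ⟨h0, hu'.2.trans hq⟩]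
        have := hE _ hu'
        rw [ht, abs_of_neg hneg] at *
        linarith
    simpa [neg_add_eq_sub, sub_eq_add_neg, add_comm] using this
  · exact mul_exp_le_integral_tuningLaw hint hpq (by linarith) hq fun u hu => by
      have h0 : 0 < u := hp.trans_le hu.1
      have ht : tuning u = Real.exp (-u⁻¹) := by
        rw [tuning, if_pos ⟨h0, hu.2.trans hq⟩]
      have := hE _ hu
      rwa [abs_of_pos hpos, ← ht] at this

/-! ### From the threshold time to the two bounds. -/

theorem exists_of_tau0_le {Ω H : Type*} [MeasurableSpace H] {V : ℕ → H → Ω → ℝ}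
    {prior ρ : Measure H} {δ : ℝ} (hδ0 : 0 < δ) (hδ1 : δ < 1) {ω : Ω} {t : ℕ}
    (h : tau0 V prior δ ρ ω ≤ t) :
    InformationTheory.klDiv ρ prior ≠ ⊤ ∧ ∃ s ≤ t,
      2 / lambda0 ^ 2 * (Real.log (4 / δ) + (InformationTheory.klDiv ρ prior).toReal) ≤
        2 * (Real.exp 1 - 2) * mixMean V ρ s ω := by
  have hl : 0 < 2 / lambda0 ^ 2 := div_pos two_pos (pow_pos lambda0_pos 2)
  have hlog : 0 < Real.log (4 / δ) := Real.log_pos (by rw [lt_div_iff₀ hδ0]; linarith)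
  have hlt : tau0 V prior δ ρ ω < (t + 1 : ℕ) :=
    h.trans_lt (by exact_mod_cast Nat.lt_succ_self t)
  rw [tau0, sInf_lt_iff] at hlt
  obtain ⟨_, ⟨s, hs, rfl⟩, hst⟩ := hlt
  have hst : s ≤ t := Nat.lt_succ_iff.1 (ENat.natCast_lt_natCast.1 hst)
  rw [Set.mem_ofPred_eq] at hs
  have hkl : InformationTheory.klDiv ρ prior ≠ ⊤ := by
    intro htop
    rw [htop, add_top, ENNReal.mul_top (ENNReal.ofReal_pos.2 hl).ne'] at hs
    exact ENNReal.ofReal_ne_top (top_le_iff.1 hs)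
  refine ⟨hkl, s, hst, ?_⟩
  rw [← ENNReal.ofReal_toReal hkl, ← ENNReal.ofReal_add hlog.le ENNReal.toReal_nonneg,
    ← ENNReal.ofReal_mul hl.le] at hs
  refine (ENNReal.ofReal_le_ofReal_iff' .. |>.1 hs).resolve_right (not_le.2 ?_)
  exact mul_pos hl (add_pos_of_pos_of_nonneg hlog ENNReal.toReal_nonneg)

theorem mul_le_of_exp_le {l m w δ K : ℝ} (hδ0 : 0 < δ)
    (h : Real.exp (l * m - l ^ 2 * w) ≤ Real.exp K * (4 / δ))
    (hw : Real.log (4 / δ) + K ≤ l ^ 2 * w) : l * m ≤ l ^ 2 * (2 * w) := by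
  rw [← Real.exp_log (show 0 < 4 / δ by positivity), ← Real.exp_add, Real.exp_le_exp] at h
  linarith

end PACBayesLIL

open PACBayesLIL in
theorem theorem1 {Ω H : Type*} {mΩ : MeasurableSpace Ω} [MeasurableSpace H]
    (P : Measure Ω) [IsProbabilityMeasure P] (F : Filtration ℕ mΩ)
    (M V : ℕ → H → Ω → ℝ)
    (hM_meas : ∀ t : ℕ, Measurable (fun p : H × Ω => M t p.1 p.2))
    (hM_mart : ∀ h : H, Martingale (fun t => M t h) F P)
    (hM_zero : ∀ h : H, ∀ᵐ ω ∂P, M 0 h ω = 0)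
    (hM_bdd : ∀ h : H, ∀ᵐ ω ∂P, ∀ t : ℕ, 1 ≤ t →
      |M t h ω - M (t - 1) h ω| ≤ Real.exp 1 ^ 2)
    (hV : PACBayesLIL.IsCondVariance P F M V)
    (prior : Measure H) [IsProbabilityMeasure prior]
    (δ : ℝ) (hδ0 : 0 < δ) (hδ1 : δ < 1) :
    ∃ G : Set Ω, MeasurableSet G ∧ ENNReal.ofReal (1 - δ) ≤ P G ∧
      ∀ ω ∈ G, ∀ (ρ : Measure H) [IsProbabilityMeasure ρ],
        (InformationTheory.klDiv ρ prior ≠ ⊤ → ∀ t : ℕ,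
          Integrable (fun h => M t h ω) ρ ∧ Integrable (fun h => V t h ω) ρ) ∧
        ∀ t : ℕ, PACBayesLIL.tau0 V prior δ ρ ω ≤ (t : ℕ∞) →
          InformationTheory.klDiv ρ prior ≠ ⊤ ∧
          |PACBayesLIL.mixMean M ρ t ω| ≤
            2 * (Real.exp 1 - 2) / (Real.exp 1 ^ 2 * (1 + Real.sqrt (1 / 3))) *
              PACBayesLIL.mixMean V ρ t ω ∧
          |PACBayesLIL.mixMean M ρ t ω| ≤
            Real.sqrt (6 * (Real.exp 1 - 2) * PACBayesLIL.mixMean V ρ t ω *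
              (2 * Real.log (Real.log
                  (3 * (Real.exp 1 - 2) * PACBayesLIL.mixMean V ρ t ω /
                    |PACBayesLIL.mixMean M ρ t ω|)) +
                Real.log (2 / δ) + (InformationTheory.klDiv ρ prior).toReal)) := by
  have hreg := ae_ae_regular P F M V hM_meas hM_zero hM_bdd hV prior
  have hc4 : 0 < 4 / δ := by positivity
  have hc2 : 0 < 2 / δ := by positivity
  have hl0 : |lambda0| ≤ Real.exp (-2) := (abs_of_pos lambda0_pos).trans_le lambda0_le
  have hl0' : |-lambda0| ≤ Real.exp (-2) := (abs_neg lambda0).trans_le hl0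
  -- Failure budget: `δ/4` for each of `±λ₀`, as mixtures over a one-point space, and `δ/2` for the
  -- continuous mixture.
  have hE1 := measure_exists_le_integral_bernsteinExp P F M V hM_meas hM_mart hM_zero hM_bdd hV
    prior (Measure.dirac ()) (ℓ := fun _ => lambda0) measurable_const (fun _ => hl0) hc4
  have hE2 := measure_exists_le_integral_bernsteinExp P F M V hM_meas hM_mart hM_zero hM_bdd hV
    prior (Measure.dirac ()) (ℓ := fun _ => -lambda0) measurable_const (fun _ => hl0') hc4
  have hE3 := measure_exists_le_integral_bernsteinExp P F M V hM_meas hM_mart hM_zero hM_bdd hV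
    prior tuningLaw measurable_tuning abs_tuning_le hc2
  rw [ae_iff] at hreg
  set E0 := {ω | ¬ ∀ t : ℕ, ∀ᵐ h ∂prior, |M t h ω| ≤ t * Real.exp 1 ^ 2 ∧ 0 ≤ V t h ω ∧
      V t h ω ≤ t * (Real.exp 1 ^ 2) ^ 2 ∧ V t h ω ≤ V (t + 1) h ω}
  set E1 := {ω | ∃ t, 4 / δ ≤ ∫ k : Unit × H, bernsteinExp lambda0 (M t k.2 ω) (V t k.2 ω)
    ∂((Measure.dirac ()).prod prior)}
  set E2 := {ω | ∃ t, 4 / δ ≤ ∫ k : Unit × H, bernsteinExp (-lambda0) (M t k.2 ω) (V t k.2 ω)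
    ∂((Measure.dirac ()).prod prior)}
  set E3 := {ω | ∃ t, 2 / δ ≤ ∫ k : ℝ × H, bernsteinExp (tuning k.1) (M t k.2 ω) (V t k.2 ω)
    ∂(tuningLaw.prod prior)}
  have hbad : P (E0 ∪ (E1 ∪ (E2 ∪ E3))) ≤ ENNReal.ofReal δ := by
    calc P (E0 ∪ (E1 ∪ (E2 ∪ E3))) ≤ P E0 + (P E1 + (P E2 + P E3)) :=
          (measure_union_le _ _).trans (add_le_add_right ((measure_union_le _ _).trans
            (add_le_add_right (measure_union_le _ _) _)) _)
      _ ≤ 0 + (ENNReal.ofReal (1 / (4 / δ)) +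
          (ENNReal.ofReal (1 / (4 / δ)) + ENNReal.ofReal (1 / (2 / δ)))) := by
        gcongr
        exact hreg.le
      _ = ENNReal.ofReal δ := by
        rw [zero_add, ← ENNReal.ofReal_add (by positivity) (by positivity),
          ← ENNReal.ofReal_add (by positivity) (by positivity)]
        congr 1
        field_simp
        norm_num
  refine ⟨(toMeasurable P (E0 ∪ (E1 ∪ (E2 ∪ E3))))ᶜ, (measurableSet_toMeasurable _ _).compl, ?_, ?_⟩
  · rw [prob_compl_eq_one_sub (measurableSet_toMeasurable _ _), measure_toMeasurable,
      ENNReal.ofReal_sub _ hδ0.le, ENNReal.ofReal_one]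
    exact tsub_le_tsub_left hbad 1
  intro ω hω ρ _
  have hω' : ω ∉ E0 ∪ (E1 ∪ (E2 ∪ E3)) := fun h => hω (subset_toMeasurable _ _ h)
  simp only [Set.mem_union, not_or] at hω'
  obtain ⟨hω0, hω1, hω2, hω3⟩ := hω'
  have hω0 := not_not.1 hω0
  have hMω : ∀ t, Measurable fun h => M t h ω := fun t =>
    (hM_meas t).comp measurable_prodMk_right
  have hVω : ∀ t, Measurable fun h => V t h ω := fun t =>
    (hV.measurable t).comp measurable_prodMk_right
  have hreg : InformationTheory.klDiv ρ prior ≠ ⊤ → ∀ t : ℕ, ∀ᵐ h ∂ρ,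
      |M t h ω| ≤ t * Real.exp 1 ^ 2 ∧ 0 ≤ V t h ω ∧
        V t h ω ≤ t * (Real.exp 1 ^ 2) ^ 2 ∧ V t h ω ≤ V (t + 1) h ω := fun hkl t =>
    (InformationTheory.klDiv_ne_top_iff.1 hkl).1.ae_le (hω0 t)
  have hint : InformationTheory.klDiv ρ prior ≠ ⊤ → ∀ t : ℕ,
      Integrable (fun h => M t h ω) ρ ∧ Integrable (fun h => V t h ω) ρ := by
    intro hkl t
    refine ⟨Integrable.of_bound (hMω t).aestronglyMeasurable _ ((hreg hkl t).mono fun h hh => hh.1),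
      Integrable.of_bound (hVω t).aestronglyMeasurable (t * (Real.exp 1 ^ 2) ^ 2)
        ((hreg hkl t).mono fun h hh => ?_)⟩
    rw [Real.norm_eq_abs, abs_of_nonneg hh.2.1]
    exact hh.2.2.1
  refine ⟨hint, fun t ht => ?_⟩
  obtain ⟨hkl, s, hst, hs⟩ := exists_of_tau0_le hδ0 hδ1 ht
  -- The threshold is met at some `s ≤ t`; monotonicity carries it to `t`.
  have hmono : Monotone fun t => mixMean V ρ t ω := monotone_nat_of_le_succ fun n =>
    integral_mono_ae (hint hkl n).2 (hint hkl (n + 1)).2 ((hreg hkl n).mono fun h hh => hh.2.2.2)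
  have hbnd : ∀ᵐ h ∂prior, |M t h ω| ≤ t * Real.exp 1 ^ 2 ∧ 0 ≤ V t h ω :=
    (hω0 t).mono fun h hh => ⟨hh.1, hh.2.1⟩
  have hcm : ∀ {L : Type} [MeasurableSpace L] (μ : Measure L) [IsProbabilityMeasure μ] {ℓ : L → ℝ}
      (_ : Measurable ℓ) (_ : ∀ u, |ℓ u| ≤ Real.exp (-2)) {c : ℝ}
      (_ : ∫ k : L × H, bernsteinExp (ℓ k.1) (M t k.2 ω) (V t k.2 ω) ∂(μ.prod prior) < c),
      ∫ u, bernsteinExp (ℓ u) (mixMean M ρ t ω) (mixMean V ρ t ω) ∂μ ≤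
        Real.exp (InformationTheory.klDiv ρ prior).toReal * c := by
    intro L _ μ _ ℓ hℓ hℓb c hc
    refine (integral_bernsteinExp_mean_le hkl μ hℓ hℓb (hMω t) (hVω t) hbnd
      (hint hkl t).1 (hint hkl t).2).trans ?_
    gcongr
  have h1 := hcm (Measure.dirac ()) (ℓ := fun _ => lambda0) measurable_const (fun _ => hl0)
    (not_le.1 fun h => hω1 ⟨t, h⟩)
  have h2 := hcm (Measure.dirac ()) (ℓ := fun _ => -lambda0) measurable_const (fun _ => hl0')
    (not_le.1 fun h => hω2 ⟨t, h⟩)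
  have h3 := hcm tuningLaw measurable_tuning abs_tuning_le (not_le.1 fun h => hω3 ⟨t, h⟩)
  have hv := hs.trans (mul_le_mul_of_nonneg_left (hmono hst)
    (mul_nonneg two_pos.le exp_one_sub_two_pos.le))
  simp only [integral_const, probReal_univ, one_smul] at h1 h2
  simp only at hv
  have hK : 0 ≤ (InformationTheory.klDiv ρ prior).toReal := ENNReal.toReal_nonneg
  generalize mixMean M ρ t ω = m at *
  generalize mixMean V ρ t ω = v at *
  generalize (InformationTheory.klDiv ρ prior).toReal = K at *
  have hlp := lambda0_pos
  have hlog : 0 < Real.log (4 / δ) := Real.log_pos (by rw [lt_div_iff₀ hδ0]; linarith)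
  have hcv : Real.log (4 / δ) + K ≤ lambda0 ^ 2 * ((Real.exp 1 - 2) * v) := by
    rw [div_mul_eq_mul_div, div_le_iff₀ (by positivity)] at hv
    linarith
  have hcvpos : 0 < (Real.exp 1 - 2) * v :=
    pos_of_mul_pos_right (lt_of_lt_of_le (by linarith) hcv) (by positivity)
  have hm1 := mul_le_of_exp_le hδ0 h1 hcv
  have hm2 := mul_le_of_exp_le hδ0 h2 (by rwa [neg_sq])
  have hmU : |m| ≤ lambda0 * (2 * ((Real.exp 1 - 2) * v)) := by
    refine abs_le'.2 ⟨le_of_mul_le_mul_left ?_ hlp, le_of_mul_le_mul_left ?_ hlp⟩ <;> linarith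
  refine ⟨hkl, ?_, ?_⟩
  · refine hmU.trans_eq ?_
    rw [lambda0]
    ring
  rcases eq_or_ne m 0 with rfl | hm
  · simp
  -- The linear bound `hmU` is exactly the admissibility condition for the mixture estimate.
  obtain ⟨hL, h4⟩ := exp_div_log_sq_le_integral_tuning hm (mul_pos two_pos hcvpos) hmU
  have heq : 3 * (2 * ((Real.exp 1 - 2) * v)) / (2 * |m|) = 3 * (Real.exp 1 - 2) * v / |m| := by
    have := abs_pos.2 hm
    field_simp
  rw [mul_div_cancel_left₀ _ two_ne_zero, heq] at h4
  rw [heq] at hL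
  have h5 := h4.trans h3
  rw [div_le_iff₀ (by positivity)] at h5
  have h6 := Real.log_le_log (Real.exp_pos _) h5
  rw [Real.log_exp, Real.log_mul (by positivity) (by positivity),
    Real.log_mul (by positivity) (by positivity), Real.log_exp, Real.log_pow,
    div_le_iff₀ (by positivity)] at h6
  push_cast at h6
  refine Real.abs_le_sqrt (h6.trans_eq ?_)
  ring
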